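/- Let $\ell$ and $p$ be prime numbers ($\ell = p$ is allowed), let $K_{\mathfrak p}$ be a finite extension of $\mathbb{Q}_p$, and let $L_{\mathfrak P}/K_{\mathfrak p}$ be a finite Galois extension whose Galois group $G=\mathrm{Gal}(L_{\mathfrak P}/K_{\mathfrak p})$ is an $\ell$-group and which is unramified (i.e. its ramification index is $e_{L_{\mathfrak P}/K_{\mathfrak p}}=1$). Let $U_{\mathfrak P}$ be the group of units of the ring of integers of $L_{\mathfrak P}$, and let $$\mathcal{U}_{L_{\mathfrak P}}=\varprojlim_{k} U_{\mathfrak P}/U_{\mathfrak P}^{\ell^k}$$ be its $\ell$-adification, viewed as a $\mathbb{Z}_\ell[G]$-module. Let $\mathrm{H}^i_\ell(G,-)$ denote the cohomology of $\mathbb{Z}_\ell[G]$-modules, computed from projective resolutions of $\mathbb{Z}_\ell$ over $\mathbb{Z}_\ell[G]$ and modified in Tate's sense in degree $0$, so that $\mathrm{H}^0_\ell(G,V)=V^G/N_G V$ with $N_G=\sum_{\sigma\in G}\sigma$. Then $$\mathrm{H}^i_\ell\bigl(G,\mathcal{U}_{L_{\mathfrak P}}\bigr)=1\qquad\text{for }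 i=0,1 .$$ -/

import Mathlib

/-! ### The `ℓ`-adification `lim_k M / ℓ^k M` of an abelian group (written additively) -/

/-- The `k`-th layer `M / ℓ^k M`. -/
def AdicLayer (ℓ : ℕ) (M : Type*) [AddCommGroup M] (k : ℕ) : Type _ :=
  ModN M (ℓ ^ k)

namespace AdicLayer

variable (ℓ : ℕ) {M N P : Type*} [AddCommGroup M] [AddCommGroup N] [AddCommGroup P]

instance (k : ℕ) : AddCommGroup (AdicLayer ℓ M k) :=
  inferInstanceAs (AddCommGroup (ModN M (ℓ ^ k)))

/-- The canonical projection `M → M / ℓ^k M`. -/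
def mk (k : ℕ) : M →+ AdicLayer ℓ M k := ModN.mkQ (ℓ ^ k)

variable {ℓ}

theorem mk_surjective (k : ℕ) : Function.Surjective (mk ℓ k : M →+ AdicLayer ℓ M k) :=
  Submodule.mkQ_surjective _

theorem mk_eq_zero_iff {k : ℕ} {m : M} : mk ℓ k m = 0 ↔ ∃ y : M, (ℓ ^ k) • y = m := by
  refine (Submodule.Quotient.mk_eq_zero _).trans ?_
  simp only [LinearMap.mem_range, LinearMap.lsmul_apply, natCast_zsmul]

theorem mk_pow_smul (k : ℕ) (m : M) : mk ℓ k ((ℓ ^ k) • m) = 0 :=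
  mk_eq_zero_iff.2 ⟨m, rfl⟩

theorem pow_smul_eq_zero (k : ℕ) (x : AdicLayer ℓ M k) : (ℓ ^ k) • x = 0 := by
  obtain ⟨m, rfl⟩ := mk_surjective k x
  rw [← map_nsmul, mk_pow_smul]

/-- Additive maps out of `M / ℓ^k M` are additive maps out of `M` that kill `ℓ^k M`. -/
def lift (k : ℕ) (f : M →+ P) (hf : ∀ m, f ((ℓ ^ k) • m) = 0) : AdicLayer ℓ M k →+ P :=
  QuotientAddGroup.lift (LinearMap.range (LinearMap.lsmul ℤ M ((ℓ ^ k : ℕ) : ℤ))).toAddSubgroup f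
    (by
      rintro _ ⟨y, rfl⟩
      rw [LinearMap.lsmul_apply, natCast_zsmul]
      exact hf y)

@[simp] theorem lift_mk (k : ℕ) (f : M →+ P) (hf : ∀ m, f ((ℓ ^ k) • m) = 0) (m : M) :
    lift k f hf (mk ℓ k m) = f m := rfl

variable (ℓ M) in
/-- The transition map `M / ℓ^(k+1) M → M / ℓ^k M`. -/
def transition (k : ℕ) : AdicLayer ℓ M (k + 1) →+ AdicLayer ℓ M k :=
  lift (k + 1) (mk ℓ k) (fun m => by rw [pow_succ, mul_smul, mk_pow_smul])

/-- The map `M / ℓ^k M → N / ℓ^k N` induced by `f : M → N`. -/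
def map (f : M →+ N) (k : ℕ) : AdicLayer ℓ M k →+ AdicLayer ℓ N k :=
  lift k ((mk ℓ k).comp f) (fun m => by
    rw [AddMonoidHom.comp_apply, map_nsmul, mk_pow_smul])

@[simp] theorem transition_mk (k : ℕ) (m : M) :
    transition ℓ M k (mk ℓ (k + 1) m) = mk ℓ k m := rfl

@[simp] theorem map_mk (f : M →+ N) (k : ℕ) (m : M) : map f k (mk ℓ k m) = mk ℓ k (f m) := rfl

theorem map_transition (f : M →+ N) (k : ℕ) (x : AdicLayer ℓ M (k + 1)) :
    map f k (transition ℓ M k x) = transition ℓ N k (map f (k + 1) x) := by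
  obtain ⟨m, rfl⟩ := mk_surjective _ x
  rfl

instance (k : ℕ) : Module (ZMod (ℓ ^ k)) (AdicLayer ℓ M k) :=
  AddCommGroup.zmodModule (pow_smul_eq_zero k)

theorem natCast_smul (k n : ℕ) (x : AdicLayer ℓ M k) : (n : ZMod (ℓ ^ k)) • x = n • x :=
  Nat.cast_smul_eq_nsmul _ _ _

variable [Fact ℓ.Prime]

/-- `ℤ_ℓ` acts on `M / ℓ^k M` through `ℤ_ℓ → ℤ / ℓ^k`. -/
noncomputable instance (k : ℕ) : Module ℤ_[ℓ] (AdicLayer ℓ M k) :=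
  Module.compHom _ (PadicInt.toZModPow k : ℤ_[ℓ] →+* ZMod (ℓ ^ k))

theorem padicInt_smul_def {k : ℕ} (a : ℤ_[ℓ]) (x : AdicLayer ℓ M k) :
    a • x = PadicInt.toZModPow k a • x := rfl

theorem transition_smul (k : ℕ) (a : ℤ_[ℓ]) (x : AdicLayer ℓ M (k + 1)) :
    transition ℓ M k (a • x) = a • transition ℓ M k x := by
  have hℓ : ℓ ≠ 0 := (Fact.out : ℓ.Prime).ne_zero
  have : NeZero (ℓ ^ (k + 1)) := ⟨pow_ne_zero _ hℓ⟩
  rw [padicInt_smul_def, padicInt_smul_def,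
    ← PadicInt.cast_toZModPow k (k + 1) (Nat.le_succ k) a]
  obtain ⟨n, hn⟩ : ∃ n : ℕ, PadicInt.toZModPow (k + 1) a = (n : ZMod (ℓ ^ (k + 1))) :=
    ⟨_, (ZMod.natCast_zmod_val _).symm⟩
  rw [hn, ZMod.cast_natCast (pow_dvd_pow ℓ (Nat.le_succ k)), natCast_smul, natCast_smul,
    map_nsmul]

theorem map_smul (f : M →+ N) (k : ℕ) (a : ℤ_[ℓ]) (x : AdicLayer ℓ M k) :
    map f k (a • x) = a • map f k x := by
  have : NeZero (ℓ ^ k) := ⟨pow_ne_zero _ (Fact.out : ℓ.Prime).ne_zero⟩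
  rw [padicInt_smul_def, padicInt_smul_def]
  obtain ⟨n, hn⟩ : ∃ n : ℕ, PadicInt.toZModPow k a = (n : ZMod (ℓ ^ k)) :=
    ⟨_, (ZMod.natCast_zmod_val _).symm⟩
  rw [hn, natCast_smul, natCast_smul, map_nsmul]

end AdicLayer

section Adification

variable (ℓ : ℕ) [Fact ℓ.Prime] {M N : Type*} [AddCommGroup M] [AddCommGroup N]

variable (M) in
/-- The `ℓ`-adification `lim_k M / ℓ^k M`, a `ℤ_ℓ`-module. -/
noncomputable def ellAdification : Submodule ℤ_[ℓ] (∀ k, AdicLayer ℓ M k) where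
  carrier := {x | ∀ k, AdicLayer.transition ℓ M k (x (k + 1)) = x k}
  add_mem' hx hy k := by simp only [Pi.add_apply, map_add, hx k, hy k]
  zero_mem' k := by simp only [Pi.zero_apply, map_zero]
  smul_mem' a x hx k := by
    simp only [Pi.smul_apply, AdicLayer.transition_smul, hx k]

/-- The `ℤ_ℓ`-linear map `lim_k M / ℓ^k M → lim_k N / ℓ^k N` induced by `f : M → N`. -/
noncomputable def ellAdificationMap (f : M →+ N) :
    ellAdification ℓ M →ₗ[ℤ_[ℓ]] ellAdification ℓ N where
  toFun x := ⟨fun k => AdicLayer.map f k (x.1 k), fun k => by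
    rw [← AdicLayer.map_transition, x.2 k]⟩
  map_add' x y := Subtype.ext <| funext fun k => map_add (AdicLayer.map f k) (x.1 k) (y.1 k)
  map_smul' a x := Subtype.ext <| funext fun k => AdicLayer.map_smul f k a (x.1 k)

/-- The `ℤ_ℓ`-linear representation on `lim_k M / ℓ^k M` induced by an additive action of `G`
on `M`. -/
noncomputable def ellAdificationRep {G : Type*} [Group G] (φ : G →* AddMonoid.End M) :
    Representation ℤ_[ℓ] G (ellAdification ℓ M) where
  toFun g := ellAdificationMap ℓ (φ g)
  map_one' := by
    ext x k
    obtain ⟨m, hm⟩ := AdicLayer.mk_surjective k (x.1 k)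
    change AdicLayer.map (φ 1) k (x.1 k) = x.1 k
    rw [← hm, map_one]
    rfl
  map_mul' g h := by
    ext x k
    obtain ⟨m, hm⟩ := AdicLayer.mk_surjective k (x.1 k)
    change AdicLayer.map (φ (g * h)) k (x.1 k) =
      AdicLayer.map (φ g) k (AdicLayer.map (φ h) k (x.1 k))
    rw [← hm, map_mul]
    rfl

end Adification

/-! ### Tate cohomology of `ℤ_ℓ`-linear representations of a finite group -/

/-- A `k`-linear representation, regarded as linear over a copy of `k` in a higher universe. -/
def Representation.uliftScalars {k G V : Type*} [CommRing k] [Group G] [AddCommGroup V]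
    [Module k V] (ρ : Representation k G V) : Representation (ULift k) G V where
  toFun g :=
    { toFun := ρ g
      map_add' := map_add (ρ g)
      map_smul' := fun a x => (ρ g).map_smul a.down x }
  map_one' := by ext x; exact LinearMap.congr_fun ρ.map_one x
  map_mul' g h := by ext x; exact LinearMap.congr_fun (ρ.map_mul g h) x

/-- `H^i_ℓ(G, V)`: the Tate cohomology in degree `i` of the `ℤ_ℓ[G]`-module `V`, for a finite
group `G`. For `i ≥ 1` it is ordinary group cohomology, i.e. `Ext^i` over `ℤ_ℓ[G]` of `ℤ_ℓ` with
values in `V`; for `i = 0` it is `V^G` modulo norms. The scalars `ℤ_ℓ` are only lifted to the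
universe of `G` and `V`. -/
noncomputable def ellCohomology.{u} (ℓ : ℕ) [Fact ℓ.Prime] {G V : Type u} [Group G] [Fintype G]
    [AddCommGroup V] [Module ℤ_[ℓ] V] (ρ : Representation ℤ_[ℓ] G V) (i : ℤ) :
    ModuleCat.{u} (ULift.{u} ℤ_[ℓ]) :=
  tateCohomology (Rep.of ρ.uliftScalars) i

/-! ### Local fields -/

section LocalField

variable (p : ℕ) [Fact p.Prime]

/-- The ring of integers of an algebraic extension `K` of `ℚ_p`: the integral closure of the
`p`-adic integers in `K`. -/
noncomputable abbrev localIntegers (K : Type*) [Field K] [Algebra ℚ_[p] K] :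
    Subalgebra (PadicInt.subring p) K :=
  integralClosure (PadicInt.subring p) K

variable (K L : Type*) [Field K] [Field L] [Algebra ℚ_[p] K] [Algebra ℚ_[p] L] [Algebra K L]
  [IsScalarTower ℚ_[p] K L]

/-- The inclusion of the ring of integers of `K` into that of `L`. -/
noncomputable def localIntegersMap : localIntegers p K →+* localIntegers p L :=
  ((IsScalarTower.toAlgHom ℚ_[p] K L).restrictScalars (PadicInt.subring p)).mapIntegralClosure

/-- `L / K` is unramified: the maximal ideal of the ring of integers of `L` has ramification
index `1` over the ring of integers of `K`. (The residue fields are finite, so that the residue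
extension is automatically separable.) -/
def IsUnramifiedLocalExtension : Prop :=
  letI : Algebra (localIntegers p K) (localIntegers p L) := (localIntegersMap p K L).toAlgebra
  ∀ P : Ideal (localIntegers p L), P.IsMaximal → P.ramificationIdx (localIntegers p K) = 1

/-- The action of `Gal(L/K)` on the ring of integers of `L`. -/
noncomputable def galoisOnIntegers : Gal(L/K) →* (localIntegers p L →+* localIntegers p L) where
  toFun σ := ((((σ : L →ₐ[K] L).restrictScalars ℚ_[p]).restrictScalars
    (PadicInt.subring p)).mapIntegralClosure : localIntegers p L →+* localIntegers p L)
  map_one' := by ext; rfl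
  map_mul' _ _ := by ext; rfl

@[simp] theorem galoisOnIntegers_apply_coe (σ : Gal(L/K)) (x : localIntegers p L) :
    (galoisOnIntegers p K L σ x : L) = σ (x : L) := rfl

/-- The action of `Gal(L/K)` on the group of units of the ring of integers of `L`, written
additively. -/
noncomputable def galoisOnUnits : Gal(L/K) →* AddMonoid.End (Additive (localIntegers p L)ˣ) where
  toFun σ := MonoidHom.toAdditive
    (Units.map (galoisOnIntegers p K L σ : localIntegers p L →* localIntegers p L))
  map_one' := rfl
  map_mul' _ _ := by ext; rfl

/-- `𝒰_L = lim_k U_L / U_L^(ℓ^k)`, where `U_L` is the group of units of the ring of integers of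
`L`, as a `ℤ_ℓ`-linear representation of `Gal(L/K)`. -/
noncomputable def ellUnitsRep (ℓ : ℕ) [Fact ℓ.Prime] :
    Representation ℤ_[ℓ] Gal(L/K) (ellAdification ℓ (Additive (localIntegers p L)ˣ)) :=
  ellAdificationRep ℓ (galoisOnUnits p K L)

end LocalField

/-! Let `U` be the unit group of the integers of `L`, with its filtration by principal units `W n`.
It is compact, and each `U / W n` has finite exponent, so the `ℓ`-adification should be the pro-`ℓ`
part of `U`, realised here as `primaryPart`. The canonical map from `U` restricts to an equivariant
bijection from this part to the adification: injective by `eq_zero_of_mem_primaryPart`, surjective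
by `exists_mem_primaryPart_toEllAdification_eq`. Invariants and cocycles therefore lift to `U`, are
solved there, and the solutions are mapped back.

It remains to treat `U`. In degree 1, Hilbert 90 gives a solution in `Lˣ`; a uniformizer of `K` is
still one of `L`, so the non-unit part of that solution is Galois-fixed and can be dropped. In
degree 0, norm and trace are surjective on finite residue fields, so successive approximation makes
every unit of `K` a norm modulo any power of the maximal ideal, and compactness gives an exact norm.
-/

section TateCohomology

/-! ### Vanishing criteria for Tate cohomology in degrees 0 and 1 -/

open CategoryTheory

universe u

variable {R G : Type u} [CommRing R] [Group G] [Fintype G]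

/-- Tate cohomology in degree `0` vanishes when every invariant is a norm. -/
theorem subsingleton_tateCohomology_zero (M : Rep R G)
    (h : ∀ x : M, (∀ g, M.ρ g x = x) → ∃ y : M, ∑ g, M.ρ g y = x) :
    Subsingleton (tateCohomology M 0) := by
  -- Around degree 0 the complex is `M → M → (G → M)`: the norm, followed by `x ↦ (g ↦ g x - x)`.
  have hex : (tateComplex M).ExactAt 0 := by
    rw [(tateComplex M).exactAt_iff' (-1) 0 1 (by simp) (by simp),
      ShortComplex.moduleCat_exact_iff]
    intro (c : (Fin 0 → G) → M) (hc : (groupCohomology.inhomogeneousCochains M).d 0 1 c = 0)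
    obtain ⟨y, hy⟩ := h (c default) fun g => by
      have h1 := ConcreteCategory.congr_hom (groupCohomology.comp_d₀₁_eq M) c
      rw [ConcreteCategory.comp_apply, ConcreteCategory.comp_apply, hc, map_zero] at h1
      exact sub_eq_zero.1 (congrFun h1 g)
    refine ⟨(Finsupp.single default y : (Fin 0 → G) →₀ M), ?_⟩
    change M.tateNorm _ = c
    rw [Rep.tateNorm_eq]
    ext i
    obtain rfl := Subsingleton.elim i default
    simp [Representation.norm, hy]
  exact ModuleCat.subsingleton_of_isZero hex.isZero_homology

/-- Tate cohomology in degree `1` vanishes when every `1`-cocycle is a coboundary. -/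
theorem subsingleton_tateCohomology_one (M : Rep R G)
    (h : ∀ f : G → M, (∀ g g', f (g * g') = f g + M.ρ g (f g')) →
      ∃ y : M, ∀ g, f g = M.ρ g y - y) :
    Subsingleton (tateCohomology M 1) := by
  have : Subsingleton (groupCohomology.H1 M) := by
    refine ⟨fun a b => ?_⟩
    suffices ∀ a : groupCohomology.H1 M, a = 0 by rw [this a, this b]
    intro a
    induction a using groupCohomology.H1_induction_on with | _ f
    rw [groupCohomology.H1π_eq_zero_iff]
    obtain ⟨y, hy⟩ := h f (fun g g' => by
      rw [(groupCohomology.mem_cocycles₁_iff (f : G → M)).1 f.2 g g', add_comm])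
    exact ⟨y, funext fun g => (hy g).symm⟩
  have e : tateCohomology M 1 ≅ groupCohomology.H1 M :=
    (TateCohomology.isoGroupCohomology (R := R) (G := G) 1).app M
  exact e.toLinearEquiv.toEquiv.subsingleton

end TateCohomology

section EllCohomology

universe u

variable {ℓ : ℕ} [Fact ℓ.Prime] {G V : Type u} [Group G] [Fintype G] [AddCommGroup V]
  [Module ℤ_[ℓ] V] (ρ : Representation ℤ_[ℓ] G V)

theorem subsingleton_ellCohomology_zero
    (h : ∀ x : V, (∀ g, ρ g x = x) → ∃ y : V, ∑ g, ρ g y = x) :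
    Subsingleton (ellCohomology ℓ ρ 0) :=
  subsingleton_tateCohomology_zero (Rep.of ρ.uliftScalars) h

theorem subsingleton_ellCohomology_one
    (h : ∀ f : G → V, (∀ g g', f (g * g') = f g + ρ g (f g')) → ∃ y : V, ∀ g, f g = ρ g y - y) :
    Subsingleton (ellCohomology ℓ ρ 1) :=
  subsingleton_tateCohomology_one (Rep.of ρ.uliftScalars) h

end EllCohomology

/-! ### The adification of a compact group as its pro-`ℓ` part -/

section CompactAdification

variable (ℓ : ℕ) {U : Type*} [AddCommGroup U]

/-- The elements of `U` whose image in `U / W n` is `ℓ`-power torsion, for every `n`. -/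
def primaryPart (W : ℕ → AddSubgroup U) : AddSubgroup U where
  carrier := {u | ∀ n, ∃ j, ℓ ^ j • u ∈ W n}
  zero_mem' n := ⟨0, by simp⟩
  add_mem' {a b} ha hb n := by
    obtain ⟨i, hi⟩ := ha n
    obtain ⟨j, hj⟩ := hb n
    refine ⟨i + j, ?_⟩
    rw [smul_add, pow_add, mul_smul (ℓ ^ i) _ b, mul_comm, mul_smul]
    exact add_mem (nsmul_mem hi _) (nsmul_mem hj _)
  neg_mem' {a} ha n := by
    obtain ⟨i, hi⟩ := ha n
    exact ⟨i, by rw [smul_neg]; exact neg_mem hi⟩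

variable {ℓ} in
theorem map_mem_primaryPart {W : ℕ → AddSubgroup U} {f : U →+ U}
    (hf : ∀ n, ∀ u ∈ W n, f u ∈ W n) {u : U}
    (hu : u ∈ primaryPart ℓ W) : f u ∈ primaryPart ℓ W := fun n => by
  obtain ⟨j, hj⟩ := hu n
  exact ⟨j, by rw [← map_nsmul]; exact hf n _ hj⟩

variable [Fact ℓ.Prime]

variable (U) in
/-- The canonical map `U → lim_k U / ℓ^k U`. -/
noncomputable def toEllAdification : U →+ ellAdification ℓ U where
  toFun u := ⟨fun k => AdicLayer.mk ℓ k u, fun _ => rfl⟩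
  map_zero' := Subtype.ext <| funext fun k => map_zero (AdicLayer.mk ℓ k)
  map_add' x y := Subtype.ext <| funext fun k => map_add (AdicLayer.mk ℓ k) x y

theorem toEllAdification_apply_coe (u : U) (k : ℕ) :
    (toEllAdification ℓ U u).1 k = AdicLayer.mk ℓ k u := rfl

theorem ellAdificationRep_toEllAdification {G : Type*} [Group G] (φ : G →* AddMonoid.End U)
    (g : G) (u : U) :
    ellAdificationRep ℓ φ g (toEllAdification ℓ U u) = toEllAdification ℓ U (φ g u) := rfl

variable {ℓ} {W : ℕ → AddSubgroup U} {N : ℕ → ℕ}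

/-- Write `N n = ℓ ^ a * m` with `m` prime to `ℓ`. An element of the kernel is divisible by `ℓ ^ a`,
so `m` kills it modulo `W n`; a power of `ℓ` kills it too, and Bézout puts it in `W n`. -/
theorem eq_zero_of_mem_primaryPart (hW : ∀ u, (∀ n, u ∈ W n) → u = 0) (hN : ∀ n, N n ≠ 0)
    (hNW : ∀ n u, N n • u ∈ W n) {u : U} (hu : u ∈ primaryPart ℓ W)
    (h0 : toEllAdification ℓ U u = 0) : u = 0 := by
  refine hW u fun n => ?_
  obtain ⟨a, m, hm, hNm⟩ := Nat.exists_eq_pow_mul_and_not_dvd (hN n) ℓ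
    (Fact.out : ℓ.Prime).ne_one
  obtain ⟨j, hj⟩ := hu n
  obtain ⟨w, rfl⟩ : ∃ w : U, ℓ ^ a • w = u :=
    AdicLayer.mk_eq_zero_iff.1 (congrFun (congrArg Subtype.val h0) a)
  have h1 : m • ℓ ^ a • w ∈ W n := by
    rw [← mul_smul, mul_comm, ← hNm]; exact hNW n w
  have hc : IsCoprime ((ℓ ^ j : ℕ) : ℤ) (m : ℤ) :=
    Nat.isCoprime_iff_coprime.2
      (((Nat.Prime.coprime_iff_not_dvd Fact.out).2 hm).pow_left j)
  obtain ⟨r, s, hrs⟩ := hc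
  rw [← one_smul ℤ (ℓ ^ a • w), ← hrs, add_smul, mul_smul, mul_smul, natCast_zsmul, natCast_zsmul]
  exact add_mem (zsmul_mem hj r) (zsmul_mem h1 s)

theorem exists_mem_primaryPart_toEllAdification_eq [TopologicalSpace U] [IsTopologicalAddGroup U]
    [CompactSpace U] [T2Space U] (hWc : ∀ n, IsClosed (W n : Set U)) (hN : ∀ n, N n ≠ 0)
    (hNW : ∀ n u, N n • u ∈ W n) (x : ellAdification ℓ U) :
    ∃ u ∈ primaryPart ℓ W, toEllAdification ℓ U u = x := by
  choose a m hm hNm using fun n => Nat.exists_eq_pow_mul_and_not_dvd (hN n) ℓ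
    (Fact.out : ℓ.Prime).ne_one
  choose u hu using fun n => AdicLayer.mk_surjective n (x.1 n)
  have hx : ∀ n d, ∃ w : U, u (n + d) = u n + ℓ ^ n • w := by
    intro n d
    induction d with
    | zero => exact ⟨0, by simp⟩
    | succ d ih =>
      obtain ⟨w, hw⟩ := ih
      have : AdicLayer.mk ℓ (n + d) (u (n + (d + 1)) - u (n + d)) = 0 := by
        rw [map_sub, hu (n + d), ← x.2 (n + d), ← add_assoc, ← hu (n + d + 1),
          AdicLayer.transition_mk, sub_self]
      obtain ⟨z, hz⟩ := AdicLayer.mk_eq_zero_iff.1 this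
      refine ⟨w + ℓ ^ d • z, ?_⟩
      rw [smul_add, ← mul_smul, ← pow_add, hz, ← add_assoc (u n), ← hw]
      abel
  -- `C n` collects the approximate solutions up to level `n`: they match `x` in the layers `j ≤ n`
  -- and are `ℓ`-primary modulo `W j`. These sets are closed and decreasing, so a common point
  -- exists once each is nonempty.
  let C : ℕ → Set U := fun n =>
    {v | ∀ j ≤ n, (∃ w, ℓ ^ j • w = v - u j) ∧ ℓ ^ a j • v ∈ W j}
  have hC : (⋂ n, C n).Nonempty := by
    have hcl : ∀ n, IsClosed (C n) := by
      intro n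
      have : C n = ⋂ j ≤ n, (((fun v => v - u j) ⁻¹' (Set.range fun w : U => ℓ ^ j • w)) ∩
          ((fun v => ℓ ^ a j • v) ⁻¹' (W j : Set U))) := by
        ext v; simp [C]
      rw [this]
      refine isClosed_biInter fun j _ => ?_
      refine IsClosed.inter (IsClosed.preimage (by fun_prop) ?_)
        (IsClosed.preimage (by fun_prop) (hWc j))
      exact (isCompact_range (by fun_prop)).isClosed
    refine IsCompact.nonempty_iInter_of_sequence_nonempty_isCompact_isClosed C
      (fun n v hv j hj => hv j (hj.trans n.le_succ)) ?_ (hcl 0).isCompact hcl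
    intro n
    -- Multiplication by `e` acts as a projector onto the `ℓ`-part: it fixes the layers up to `n`
    -- and kills the prime-to-`ℓ` part modulo each `W j`, `j ≤ n`.
    obtain ⟨e, he1, he2⟩ : ∃ e : ℕ, e ≡ 1 [MOD ℓ ^ n] ∧
        e ≡ 0 [MOD ∏ j ∈ Finset.range (n + 1), m j] := by
      have : Nat.Coprime (ℓ ^ n) (∏ j ∈ Finset.range (n + 1), m j) :=
        Nat.Coprime.pow_left _ <| Nat.Coprime.prod_right fun j _ =>
          (Nat.Prime.coprime_iff_not_dvd Fact.out).2 (hm j)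
      exact ⟨_, (Nat.chineseRemainder this 1 0).2⟩
    refine ⟨e • u n, fun j hj => ⟨?_, ?_⟩⟩
    · obtain ⟨w, hw⟩ := hx j (n - j)
      rw [Nat.add_sub_cancel' hj] at hw
      obtain ⟨r, hr⟩ : ((ℓ ^ j : ℕ) : ℤ) ∣ (e : ℤ) - 1 := by
        have := (Nat.modEq_iff_dvd.1 (he1.of_dvd (pow_dvd_pow ℓ hj)).symm)
        simpa using this
      refine ⟨r • u n + w, ?_⟩
      have h2 : (e : ℤ) = (ℓ ^ j : ℕ) * r + 1 := by rw [← hr]; ring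
      rw [← natCast_zsmul (u n) e, h2, add_smul, one_smul, mul_smul, natCast_zsmul, smul_add]
      nth_rw 3 [hw]
      abel
    · obtain ⟨c, hc⟩ : m j ∣ e :=
        (Finset.dvd_prod_of_mem m (Finset.mem_range.2 (Nat.lt_succ_of_le hj))).trans
          ((Nat.modEq_zero_iff_dvd).1 he2)
      rw [hc, ← mul_smul, ← mul_assoc, ← hNm, mul_smul]
      exact hNW j _
  obtain ⟨v, hv⟩ := hC
  have hv' : ∀ n, (∃ w, ℓ ^ n • w = v - u n) ∧ ℓ ^ a n • v ∈ W n := fun n =>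
    Set.mem_iInter.1 hv n n le_rfl
  refine ⟨v, fun n => ⟨a n, (hv' n).2⟩, Subtype.ext <| funext fun n => ?_⟩
  rw [toEllAdification_apply_coe, ← hu n, ← sub_eq_zero, ← map_sub]
  exact AdicLayer.mk_eq_zero_iff.2 (hv' n).1

variable [TopologicalSpace U] [IsTopologicalAddGroup U] [CompactSpace U] [T2Space U]
  {G : Type*} [Group G] (φ : G →* AddMonoid.End U)

/-- If every invariant of `U` is a norm, then so is every invariant of its `ℓ`-adification. -/
theorem exists_norm_eq_ellAdification [Fintype G] (hWc : ∀ n, IsClosed (W n : Set U))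
    (hW : ∀ u, (∀ n, u ∈ W n) → u = 0) (hN : ∀ n, N n ≠ 0) (hNW : ∀ n u, N n • u ∈ W n)
    (hφ : ∀ g n, ∀ u ∈ W n, φ g u ∈ W n)
    (h : ∀ u, (∀ g, φ g u = u) → ∃ v, ∑ g, φ g v = u) (x : ellAdification ℓ U)
    (hx : ∀ g, ellAdificationRep ℓ φ g x = x) : ∃ y, ∑ g, ellAdificationRep ℓ φ g y = x := by
  obtain ⟨u, hu, rfl⟩ := exists_mem_primaryPart_toEllAdification_eq hWc hN hNW x
  -- The lift `u` is itself invariant: `φ g u - u` is primary with zero image.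
  obtain ⟨v, hv⟩ := h u fun g => by
    rw [← sub_eq_zero]
    refine eq_zero_of_mem_primaryPart hW hN hNW
      (sub_mem (map_mem_primaryPart (f := φ g) (hφ g) hu) hu) ?_
    rw [map_sub, ← ellAdificationRep_toEllAdification, hx, sub_self]
  -- `v` need not be primary; only its image matters.
  exact ⟨toEllAdification ℓ U v, by
    simp_rw [ellAdificationRep_toEllAdification, ← map_sum, hv]⟩

/-- If every `1`-cocycle with values in `U` is a coboundary, then so is every `1`-cocycle with
values in its `ℓ`-adification. -/
theorem exists_coboundary_eq_ellAdification (hWc : ∀ n, IsClosed (W n : Set U))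
    (hW : ∀ u, (∀ n, u ∈ W n) → u = 0) (hN : ∀ n, N n ≠ 0) (hNW : ∀ n u, N n • u ∈ W n)
    (hφ : ∀ g n, ∀ u ∈ W n, φ g u ∈ W n)
    (h : ∀ f : G → U, (∀ g g', f (g * g') = f g + φ g (f g')) → ∃ y, ∀ g, f g = φ g y - y)
    (f : G → ellAdification ℓ U)
    (hf : ∀ g g', f (g * g') = f g + ellAdificationRep ℓ φ g (f g')) :
    ∃ y, ∀ g, f g = ellAdificationRep ℓ φ g y - y := by
  choose F hF hFf using fun g => exists_mem_primaryPart_toEllAdification_eq hWc hN hNW (f g)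
  -- The cocycle defect of `F` is primary with zero image, hence zero.
  obtain ⟨y, hy⟩ := h F fun g g' => by
    rw [← sub_eq_zero]
    refine eq_zero_of_mem_primaryPart hW hN hNW (sub_mem (hF _)
      (add_mem (hF _) (map_mem_primaryPart (f := φ g) (hφ g) (hF g')))) ?_
    rw [map_sub, map_add, ← ellAdificationRep_toEllAdification, hFf, hFf, hFf, hf, sub_self]
  exact ⟨toEllAdification ℓ U y, fun g => by
    rw [ellAdificationRep_toEllAdification, ← map_sub, ← hy, hFf]⟩

end CompactAdification

/-! ### Norms modulo powers of the maximal ideal -/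

section NormApproximation

open IsLocalRing

variable {A B : Type*} [CommRing A] [IsLocalRing A] [CommRing B] [Algebra A B]
  [Module.Free A B] [Module.Finite A B]

-- A basis of `B` over `A` reduces to a basis of the quotient, so the multiplication matrix, and
-- with it the determinant, reduces entrywise.
attribute [local instance] Ideal.Quotient.field in
theorem Algebra.norm_quotient_mk_maximalIdeal (x : B) :
    Algebra.norm (A ⧸ maximalIdeal A)
        (Ideal.Quotient.mk ((maximalIdeal A).map (algebraMap A B)) x) =
      Ideal.Quotient.mk (maximalIdeal A) (Algebra.norm A x) := by
  let b := Module.Free.chooseBasis A B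
  rw [Algebra.norm_eq_matrix_det b, Algebra.norm_eq_matrix_det (basisQuotient b),
    RingHom.map_det]
  congr 1
  ext i j
  simp only [Algebra.leftMulMatrix_apply, Algebra.coe_lmul_eq_mul, LinearMap.toMatrix_apply,
    basisQuotient_apply, LinearMap.mul_apply', RingHom.mapMatrix_apply, Matrix.map_apply,
    ← map_mul, basisQuotient_repr]

variable [Finite (B ⧸ (maximalIdeal A).map (algebraMap A B))]

attribute [local instance] Ideal.Quotient.field in
/-- In an unramified extension with finite residue fields, the norm is surjective modulo the
maximal ideal. -/
theorem exists_norm_sub_mem_maximalIdeal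
    (hmax : ((maximalIdeal A).map (algebraMap A B)).IsMaximal) (a : A) :
    ∃ y : B, Algebra.norm A y - a ∈ maximalIdeal A := by
  obtain ⟨y, hy⟩ := FiniteField.norm_surjective (A ⧸ maximalIdeal A)
    (B ⧸ (maximalIdeal A).map (algebraMap A B)) (Ideal.Quotient.mk _ a)
  obtain ⟨y, rfl⟩ := Ideal.Quotient.mk_surjective y
  refine ⟨y, Ideal.Quotient.eq.1 ?_⟩
  rw [← hy, ← Algebra.norm_quotient_mk_maximalIdeal]

attribute [local instance] Ideal.Quotient.field in
/-- In an unramified extension with finite residue fields, the trace is surjective modulo the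
maximal ideal. -/
theorem exists_trace_sub_mem_maximalIdeal
    (hmax : ((maximalIdeal A).map (algebraMap A B)).IsMaximal) (a : A) :
    ∃ y : B, Algebra.trace A B y - a ∈ maximalIdeal A := by
  have : Finite (A ⧸ maximalIdeal A) := Finite.of_injective _
    (algebraMap (A ⧸ maximalIdeal A) (B ⧸ (maximalIdeal A).map (algebraMap A B))).injective
  obtain ⟨y, hy⟩ := Algebra.trace_surjective (A ⧸ maximalIdeal A)
    (B ⧸ (maximalIdeal A).map (algebraMap A B)) (Ideal.Quotient.mk _ a)
  obtain ⟨y, rfl⟩ := Ideal.Quotient.mk_surjective y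
  refine ⟨y, Ideal.Quotient.eq.1 ?_⟩
  rw [← hy, ← Algebra.trace_quotient_mk]

/-- In an unramified extension of discrete valuation rings with finite residue fields, every unit
is a norm up to arbitrarily high order. -/
theorem exists_norm_sub_mem_maximalIdeal_pow [(maximalIdeal A).IsPrincipal]
    (hmax : ((maximalIdeal A).map (algebraMap A B)).IsMaximal) {a : A}
    (ha : IsUnit a) (n : ℕ) : ∃ y : B, Algebra.norm A y - a ∈ maximalIdeal A ^ (n + 1) := by
  induction n with
  | zero => simpa using exists_norm_sub_mem_maximalIdeal hmax a
  | succ n ih =>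
    obtain ⟨y, hy⟩ := ih
    obtain ⟨π, hπ⟩ := Submodule.IsPrincipal.principal (maximalIdeal A)
    replace hπ : maximalIdeal A = Ideal.span {π} := hπ
    obtain ⟨d, hd⟩ : ∃ d, d * π ^ (n + 1) = Algebra.norm A y - a := by
      rwa [hπ, Ideal.span_singleton_pow, Ideal.mem_span_singleton'] at hy
    obtain ⟨v, hv⟩ : IsUnit (Algebra.norm A y) := by
      have : Algebra.norm A y - a ∈ maximalIdeal A := Ideal.pow_le_self (by simp) hy
      by_contra hcon
      exact (mem_maximalIdeal a).1
        (by simpa using sub_mem ((mem_maximalIdeal _).2 hcon) this) ha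
    -- Since `N(1 + π^(n+1) z) = 1 + π^(n+1) Tr z + r π^(2n+2)`, the error `d π^(n+1)` of `N y = v`
    -- is cancelled to the next order when `Tr z ≡ -v⁻¹ d` modulo `π`.
    obtain ⟨z, hz⟩ := exists_trace_sub_mem_maximalIdeal hmax (-(↑v⁻¹ * d))
    obtain ⟨r, hr⟩ := Algebra.norm_one_add_smul (π ^ (n + 1)) z
    refine ⟨y * (1 + π ^ (n + 1) • z), ?_⟩
    rw [hπ, Ideal.mem_span_singleton'] at hz
    obtain ⟨c, hc⟩ := hz
    rw [map_mul, hr, hπ, Ideal.span_singleton_pow, Ideal.mem_span_singleton', ← hv]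
    rw [← hv] at hd
    have hvv : (v : A) * ↑v⁻¹ = 1 := v.mul_inv
    refine ⟨v * c + v * r * π ^ n, ?_⟩
    linear_combination (v : A) * π ^ (n + 1) * hc + hd + d * π ^ (n + 1) * hvv

end NormApproximation

/-! ### Compactness of finite free modules -/

section ModuleTopology

variable (R M : Type*) [CommRing R] [TopologicalSpace R] [IsTopologicalRing R] [AddCommGroup M]
  [Module R M] [Module.Finite R M] [Module.Free R M] [TopologicalSpace M] [IsModuleTopology R M]

theorem Module.nonempty_homeomorph_pi :
    Nonempty (M ≃ₜ (Module.Free.ChooseBasisIndex R M → R)) := by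
  let e := (Module.Free.chooseBasis R M).equivFun
  have := IsModuleTopology.toContinuousAdd R M
  exact ⟨e.toEquiv, IsModuleTopology.continuous_of_linearMap e.toLinearMap,
    IsModuleTopology.continuous_of_linearMap e.symm.toLinearMap⟩

theorem Module.compactSpace_of_isModuleTopology [CompactSpace R] : CompactSpace M :=
  (nonempty_homeomorph_pi R M).some.symm.compactSpace

theorem Module.t2Space_of_isModuleTopology [T2Space R] : T2Space M :=
  (nonempty_homeomorph_pi R M).some.symm.t2Space

end ModuleTopology

section PadicInt

variable (p : ℕ) [Fact p.Prime]

instance : CompactSpace (PadicInt.subring p) := inferInstanceAs (CompactSpace ℤ_[p])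

instance : IsDiscreteValuationRing (PadicInt.subring p) :=
  inferInstanceAs (IsDiscreteValuationRing ℤ_[p])

instance : IsFractionRing (PadicInt.subring p) ℚ_[p] :=
  inferInstanceAs (IsFractionRing ℤ_[p] ℚ_[p])

end PadicInt

/-! ### The integers of a local field: a compact discrete valuation ring -/

section LocalIntegers

variable (p : ℕ) [Fact p.Prime] (K : Type*) [Field K] [Algebra ℚ_[p] K]

instance : FaithfulSMul (PadicInt.subring p) (localIntegers p K) := by
  rw [faithfulSMul_iff_algebraMap_injective]
  refine fun a b h => (FaithfulSMul.algebraMap_injective (PadicInt.subring p) ℚ_[p]) ?_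
  exact (algebraMap ℚ_[p] K).injective (congrArg Subtype.val h)

theorem not_isField_localIntegers : ¬ IsField (localIntegers p K) := by
  intro h
  exact IsDiscreteValuationRing.not_isField (PadicInt.subring p)
    (isField_of_isIntegral_of_isField
      (FaithfulSMul.algebraMap_injective (PadicInt.subring p) (localIntegers p K)) h)

variable [FiniteDimensional ℚ_[p] K]

/-- Both sides say that the minimal polynomial over `ℚ_[p]` has coefficients in the `p`-adic
integers, which are integrally closed. -/
theorem isIntegral_padic_iff_spectralNorm_le_one (x : K) :
    IsIntegral (PadicInt.subring p) x ↔ spectralNorm ℚ_[p] K x ≤ 1 := by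
  rw [spectralNorm, spectralValue_le_one_iff
    (minpoly.monic (Algebra.IsIntegral.isIntegral (R := ℚ_[p]) x))]
  constructor
  · intro hx n
    rw [minpoly.isIntegrallyClosed_eq_field_fractions' ℚ_[p] hx, Polynomial.coeff_map]
    exact ((minpoly (PadicInt.subring p) x).coeff n).2
  · intro h
    refine ⟨(minpoly ℚ_[p] x).toSubring (PadicInt.subring p) ?_, ?_, ?_⟩
    · intro c hc
      obtain ⟨n, -, rfl⟩ := Polynomial.mem_coeffs_iff.1 hc
      exact h n
    · exact (Polynomial.monic_toSubring _ _ _).2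
        (minpoly.monic (Algebra.IsIntegral.isIntegral (R := ℚ_[p]) x))
    · have h1 : Polynomial.map (algebraMap (PadicInt.subring p) ℚ_[p])
          ((minpoly ℚ_[p] x).toSubring (PadicInt.subring p) (by
            intro c hc
            obtain ⟨n, -, rfl⟩ := Polynomial.mem_coeffs_iff.1 hc
            exact h n)) = minpoly ℚ_[p] x := Polynomial.map_toSubring _ _ _
      rw [← Polynomial.aeval_def, ← Polynomial.aeval_map_algebraMap ℚ_[p], h1, minpoly.aeval]

instance : IsDedekindDomain (localIntegers p K) :=
  integralClosure.isDedekindDomain (PadicInt.subring p) ℚ_[p] K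

instance : Module.Finite (PadicInt.subring p) (localIntegers p K) :=
  IsIntegralClosure.finite (PadicInt.subring p) ℚ_[p] K _

instance : IsFractionRing (localIntegers p K) K :=
  IsIntegralClosure.isFractionRing_of_finite_extension (PadicInt.subring p) ℚ_[p] K _

instance : Module.IsTorsionFree (PadicInt.subring p) (localIntegers p K) :=
  Module.isTorsionFree_iff_algebraMap_injective.2 (FaithfulSMul.algebraMap_injective _ _)

instance : Module.Free (PadicInt.subring p) (localIntegers p K) := inferInstance

/-- The spectral norm is multiplicative, so `x` or `x⁻¹` has norm at most 1. -/
instance : ValuationRing (localIntegers p K) := by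
  rw [ValuationRing.iff_isInteger_or_isInteger _ K]
  intro x
  suffices IsIntegral (PadicInt.subring p) x ∨ IsIntegral (PadicInt.subring p) x⁻¹ from
    this.imp (fun h => ⟨⟨x, h⟩, rfl⟩) (fun h => ⟨⟨x⁻¹, h⟩, rfl⟩)
  rw [isIntegral_padic_iff_spectralNorm_le_one, isIntegral_padic_iff_spectralNorm_le_one,
    ← spectralMulAlgNorm_def, ← spectralMulAlgNorm_def, map_inv₀]
  exact (le_total _ _).imp_right inv_le_one_of_one_le₀

instance : IsDiscreteValuationRing (localIntegers p K) :=
  ((IsDiscreteValuationRing.TFAE (localIntegers p K)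
    (not_isField_localIntegers p K)).out 0 1 rfl rfl).2
    inferInstance

/-- With the module topology, a finite basis gives compactness and separation, and linear maps such
as Galois automorphisms are automatically continuous. -/
noncomputable instance : TopologicalSpace (localIntegers p K) :=
  moduleTopology (PadicInt.subring p) (localIntegers p K)

instance : IsModuleTopology (PadicInt.subring p) (localIntegers p K) := ⟨rfl⟩

instance : IsTopologicalRing (localIntegers p K) :=
  IsModuleTopology.isTopologicalRing (PadicInt.subring p) (localIntegers p K)

instance : CompactSpace (localIntegers p K) :=
  (Module.compactSpace_of_isModuleTopology (PadicInt.subring p) (localIntegers p K))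

instance : T2Space (localIntegers p K) :=
  (Module.t2Space_of_isModuleTopology (PadicInt.subring p) (localIntegers p K))

end LocalIntegers

/-! ### Units in an unramified extension of local fields -/

section UnramifiedLocalExtension

open IsLocalRing

variable (p : ℕ) [Fact p.Prime] (K L : Type*) [Field K] [Field L]
  [Algebra ℚ_[p] K] [Algebra ℚ_[p] L] [Algebra K L] [IsScalarTower ℚ_[p] K L]

noncomputable instance : Algebra (localIntegers p K) (localIntegers p L) :=
  (localIntegersMap p K L).toAlgebra

@[simp] theorem algebraMap_localIntegers_coe (x : localIntegers p K) :
    (algebraMap (localIntegers p K) (localIntegers p L) x : L) = algebraMap K L x := rfl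

instance : IsScalarTower (PadicInt.subring p) (localIntegers p K) (localIntegers p L) :=
  IsScalarTower.of_algebraMap_eq fun x => Subtype.ext <|
    IsScalarTower.algebraMap_apply ℚ_[p] K L (x : ℚ_[p])

instance : IsScalarTower (localIntegers p K) (localIntegers p L) L :=
  IsScalarTower.of_algebraMap_eq fun _ => rfl

instance : FaithfulSMul (localIntegers p K) (localIntegers p L) := by
  rw [faithfulSMul_iff_algebraMap_injective]
  exact fun a b h => Subtype.ext ((algebraMap K L).injective (congrArg Subtype.val h))

instance : Module.IsTorsionFree (localIntegers p K) (localIntegers p L) :=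
  Module.isTorsionFree_iff_algebraMap_injective.2 (FaithfulSMul.algebraMap_injective _ _)

theorem galoisOnIntegers_continuous (σ : Gal(L/K)) :
    Continuous (galoisOnIntegers p K L σ) := by
  have := IsModuleTopology.toContinuousAdd (PadicInt.subring p) (localIntegers p L)
  exact IsModuleTopology.continuous_of_linearMap (R := PadicInt.subring p)
    ((((σ : L →ₐ[K] L).restrictScalars ℚ_[p]).restrictScalars
      (PadicInt.subring p)).mapIntegralClosure).toLinearMap

variable [FiniteDimensional ℚ_[p] L]

instance : Module.Finite (localIntegers p K) (localIntegers p L) :=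
  Module.Finite.of_restrictScalars_finite (PadicInt.subring p) _ _

variable {p K L}

instance (n : ℕ) : Finite (localIntegers p L ⧸ maximalIdeal (localIntegers p L) ^ n) :=
  IsLocalRing.isOpen_iff_finite_quotient.1 (IsLocalRing.isOpen_maximalIdeal_pow _ n)

instance : T2Space (Additive (localIntegers p L)ˣ) :=
  inferInstanceAs (T2Space (localIntegers p L)ˣ)

variable (p L) in
/-- The group of units congruent to `1` modulo the `n`-th power of the maximal ideal. -/
noncomputable def principalUnits (n : ℕ) : AddSubgroup (Additive (localIntegers p L)ˣ) :=
  (MonoidHom.toAdditive (Units.map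
    (Ideal.Quotient.mk (maximalIdeal (localIntegers p L) ^ n)).toMonoidHom)).ker

theorem mem_principalUnits {n : ℕ} {u : Additive (localIntegers p L)ˣ} :
    u ∈ principalUnits p L n ↔
      (u.toMul : localIntegers p L) - 1 ∈ maximalIdeal (localIntegers p L) ^ n := by
  rw [← Ideal.Quotient.eq, map_one, principalUnits, AddMonoidHom.mem_ker, ← toMul_eq_one,
    Units.ext_iff]
  rfl

theorem isClosed_principalUnits (n : ℕ) :
    IsClosed (principalUnits p L n : Set (Additive (localIntegers p L)ˣ)) := by
  have hc : IsClosed ((maximalIdeal (localIntegers p L) ^ n : Ideal _) : Set (localIntegers p L)) :=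
    inferInstance
  have hf : Continuous fun u : Additive (localIntegers p L)ˣ =>
      (u.toMul : localIntegers p L) - 1 :=
    (Units.continuous_val.comp continuous_toMul).sub continuous_const
  convert hc.preimage hf using 1
  ext u
  exact mem_principalUnits

theorem eq_zero_of_forall_mem_principalUnits {u : Additive (localIntegers p L)ˣ}
    (hu : ∀ n, u ∈ principalUnits p L n) : u = 0 := by
  have h := Ideal.iInf_pow_eq_bot_of_isLocalRing _
    (maximalIdeal.isMaximal (localIntegers p L)).ne_top
  have h1 : (u.toMul : localIntegers p L) - 1 ∈ ⨅ n, maximalIdeal (localIntegers p L) ^ n :=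
    Ideal.mem_iInf.2 fun n => mem_principalUnits.1 (hu n)
  rw [h, Ideal.mem_bot, sub_eq_zero] at h1
  exact toMul_eq_one.1 (Units.ext h1)

theorem card_smul_mem_principalUnits (n : ℕ) (u : Additive (localIntegers p L)ˣ) :
    Nat.card (localIntegers p L ⧸ maximalIdeal (localIntegers p L) ^ n)ˣ • u ∈
      principalUnits p L n := by
  rw [principalUnits, AddMonoidHom.mem_ker, map_nsmul]
  exact pow_card_eq_one' (G := (localIntegers p L ⧸ maximalIdeal (localIntegers p L) ^ n)ˣ)

theorem galoisOnIntegers_mem_maximalIdeal_pow (σ : Gal(L/K)) {n : ℕ} {x : localIntegers p L}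
    (hx : x ∈ maximalIdeal (localIntegers p L) ^ n) :
    galoisOnIntegers p K L σ x ∈ maximalIdeal (localIntegers p L) ^ n := by
  have hle : (maximalIdeal (localIntegers p L)).map (galoisOnIntegers p K L σ) ≤
      maximalIdeal (localIntegers p L) := by
    rw [Ideal.map_le_iff_le_comap]
    intro y hy
    rw [Ideal.mem_comap, mem_maximalIdeal, mem_nonunits_iff]
    intro hu
    refine hy ?_
    have := hu.map (galoisOnIntegers p K L σ⁻¹)
    have h1 : galoisOnIntegers p K L σ⁻¹ (galoisOnIntegers p K L σ y) = y :=
      Subtype.ext (σ.symm_apply_apply (y : L))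
    rwa [h1] at this
  have := Ideal.mem_map_of_mem (galoisOnIntegers p K L σ) hx
  rw [Ideal.map_pow] at this
  exact Ideal.pow_right_mono hle n this

theorem galoisOnUnits_mem_principalUnits (σ : Gal(L/K)) (n : ℕ)
    (u : Additive (localIntegers p L)ˣ) (hu : u ∈ principalUnits p L n) :
    galoisOnUnits p K L σ u ∈ principalUnits p L n := by
  rw [mem_principalUnits] at hu ⊢
  have := galoisOnIntegers_mem_maximalIdeal_pow σ hu
  rwa [map_sub, map_one] at this

variable [FiniteDimensional ℚ_[p] K]

instance : Module.Free (localIntegers p K) (localIntegers p L) := inferInstance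

/-- The extended ideal is some power `n` of the maximal ideal of `L`. The ramification index is the
largest exponent whose power contains it, so `n = 1`. -/
theorem map_maximalIdeal_of_isUnramified (h : IsUnramifiedLocalExtension p K L) :
    (maximalIdeal (localIntegers p K)).map
      (algebraMap (localIntegers p K) (localIntegers p L)) = maximalIdeal (localIntegers p L) := by
  have h1 : (maximalIdeal (localIntegers p L)).ramificationIdx (localIntegers p K) = 1 :=
    h _ inferInstance
  have hne : maximalIdeal (localIntegers p K) ≠ ⊥ :=
    IsDiscreteValuationRing.not_a_field _
  have hne' : (maximalIdeal (localIntegers p K)).map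
      (algebraMap (localIntegers p K) (localIntegers p L)) ≠ ⊥ := Ideal.map_ne_bot_of_ne_bot hne
  rw [← Ideal.ramificationIdx'_eq_ramificationIdx (maximalIdeal (localIntegers p K)) _ hne] at h1
  obtain ⟨n, hn⟩ := ((IsDiscreteValuationRing.TFAE (localIntegers p L)
    (not_isField_localIntegers p L)).out 0 6 rfl rfl).1 inferInstance _ hne'
  have hmem : ∀ k ∈ {k | (maximalIdeal (localIntegers p K)).map
      (algebraMap (localIntegers p K) (localIntegers p L)) ≤
        maximalIdeal (localIntegers p L) ^ k}, k ≤ n := by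
    intro k hk
    rw [Set.mem_ofPred_eq, hn] at hk
    by_contra! hcon
    exact (Ideal.pow_right_strictAnti _ (IsDiscreteValuationRing.not_a_field _)
      (maximalIdeal.isMaximal _).ne_top hcon).not_ge hk
  have hn1 : n = 1 := by
    rw [← h1]
    exact (IsGreatest.csSup_eq ⟨hn.le, hmem⟩).symm
  rw [hn, hn1, pow_one]

variable [FiniteDimensional K L]

/-- In an unramified extension, every `1`-cocycle with values in the units is a coboundary. -/
theorem exists_coboundary_eq_of_isUnramified (h : IsUnramifiedLocalExtension p K L)
    (f : Gal(L/K) → Additive (localIntegers p L)ˣ)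
    (hf : ∀ g g', f (g * g') = f g + galoisOnUnits p K L g (f g')) :
    ∃ y, ∀ g, f g = galoisOnUnits p K L g y - y := by
  let ι : (localIntegers p L)ˣ →* Lˣ := Units.map (algebraMap (localIntegers p L) L).toMonoidHom
  have hι : Function.Injective ι := Units.map_injective Subtype.val_injective
  -- Hilbert 90, applied in `Lˣ`.
  obtain ⟨b, hb⟩ := groupCohomology.isMulCoboundary₁_of_isMulCocycle₁_of_aut_to_units
    (fun g => ι (f g).toMul) fun g g' => by
      simp only [hf, toMul_add, map_mul]
      exact mul_comm _ _
  obtain ⟨π, hπ⟩ := IsDiscreteValuationRing.exists_irreducible (localIntegers p K)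
  have hπ' : Irreducible (algebraMap (localIntegers p K) (localIntegers p L) π) := by
    rw [IsDiscreteValuationRing.irreducible_iff_uniformizer,
      ← map_maximalIdeal_of_isUnramified h, hπ.maximalIdeal_eq, Ideal.map_span,
      Set.image_singleton]
  -- Write `b = w π^n` with `π` in `K`: the factor `π^n` is Galois-fixed and cancels in `g b / b`,
  -- so the unit `w` has the same coboundary.
  obtain ⟨n, w, hw⟩ :=
    IsDiscreteValuationRing.exists_units_eq_smul_zpow_of_irreducible hπ' b.ne_zero
  refine ⟨.ofMul w, fun g => Additive.toMul.injective (hι ?_)⟩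
  refine Units.ext ?_
  have hbg := congrArg Units.val (hb g)
  have hbg' : g (b : L) / b = ((f g).toMul : localIntegers p L) :=
    (Units.val_div_eq_div_val (g • b) b).symm.trans hbg
  have hw' : (b : L) = (w : localIntegers p L) * algebraMap K L π ^ n := hw
  have hπ0 : algebraMap K L π ≠ 0 := by
    intro h0
    exact hπ'.ne_zero (Subtype.ext h0)
  change ((f g).toMul : localIntegers p L) = ((((galoisOnUnits p K L g (.ofMul w) -
    .ofMul w : Additive (localIntegers p L)ˣ).toMul : localIntegers p L)) : L)
  have hdiv : ((((galoisOnUnits p K L g (.ofMul w) - .ofMul w :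
      Additive (localIntegers p L)ˣ).toMul : localIntegers p L)) : L) =
      g (w : localIntegers p L) / (w : localIntegers p L) := by
    refine eq_div_of_mul_eq (by simp) ?_
    have h1 : (galoisOnUnits p K L g (.ofMul w) - .ofMul w) + .ofMul w =
      galoisOnUnits p K L g (.ofMul w) := sub_add_cancel _ _
    exact congrArg (fun v : Additive (localIntegers p L)ˣ =>
      ((v.toMul : localIntegers p L) : L)) h1
  rw [hdiv, ← hbg', hw', map_mul, map_zpow₀, AlgEquiv.commutes,
    mul_div_mul_right _ _ (zpow_ne_zero n hπ0)]

variable [IsGalois K L]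

theorem algebraMap_norm_localIntegers (y : localIntegers p L) :
    algebraMap (localIntegers p K) (localIntegers p L) (Algebra.norm (localIntegers p K) y) =
      ∏ σ : Gal(L/K), galoisOnIntegers p K L σ y := by
  have : IsIntegralClosure (localIntegers p L) (localIntegers p K) L :=
    IsIntegralClosure.of_isIntegrallyClosed _ _ _
  have : IsLocalization (Algebra.algebraMapSubmonoid (localIntegers p L)
      (nonZeroDivisors (localIntegers p K))) L :=
    IsIntegralClosure.isLocalization (localIntegers p K) K L _
  refine Subtype.ext ?_
  have h1 := Algebra.norm_localization (localIntegers p K) (nonZeroDivisors (localIntegers p K))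
    (Rₘ := K) (Sₘ := L) y
  have h2 := Algebra.norm_eq_prod_automorphisms K (y : L)
  rw [algebraMap_localIntegers_coe]
  refine (congrArg (algebraMap K L) h1.symm).trans (h2.trans ?_)
  exact (map_prod (algebraMap (localIntegers p L) L)
    (fun σ : Gal(L/K) => galoisOnIntegers p K L σ y) Finset.univ).symm

/-- In an unramified extension, every Galois-invariant unit is a norm of a unit. -/
theorem exists_norm_eq_of_isUnramified (h : IsUnramifiedLocalExtension p K L)
    (u : Additive (localIntegers p L)ˣ) (hu : ∀ σ, galoisOnUnits p K L σ u = u) :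
    ∃ v, ∑ σ, galoisOnUnits p K L σ v = u := by
  have hfix : ∀ u : (localIntegers p L)ˣ, (∀ σ, galoisOnUnits p K L σ (.ofMul u) = .ofMul u) →
      ∃ a : localIntegers p K, algebraMap (localIntegers p K) (localIntegers p L) a = u := by
    intro u hu
    obtain ⟨a, ha⟩ := (IsGalois.mem_range_algebraMap_iff_fixed (F := K)
      ((u : localIntegers p L) : L)).2 fun σ =>
        congrArg (fun w : Additive (localIntegers p L)ˣ => ((w.toMul : localIntegers p L) : L))
          (hu σ)
    refine ⟨⟨a, ?_⟩, Subtype.ext ha⟩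
    have hint : IsIntegral (PadicInt.subring p) (algebraMap K L a) := by
      rw [ha]; exact (u : localIntegers p L).2
    exact (isIntegral_algebraMap_iff (algebraMap K L).injective).1 hint
  obtain ⟨u, rfl⟩ := Additive.ofMul.surjective u
  obtain ⟨a, ha⟩ := hfix u hu
  -- The inverse of `a` comes from the descent of `u⁻¹`.
  have hau : IsUnit a := by
    obtain ⟨a', ha'⟩ := hfix u⁻¹ fun σ => by rw [ofMul_inv, map_neg, hu]
    refine IsUnit.of_mul_eq_one a' (FaithfulSMul.algebraMap_injective _ (localIntegers p L) ?_)
    rw [map_mul, ha, ha', map_one, u.mul_inv]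
  let Nm : localIntegers p L → localIntegers p L := fun y => ∏ σ, galoisOnIntegers p K L σ y
  have hNm : Continuous Nm := continuous_finsetProd _ fun σ _ => galoisOnIntegers_continuous p K L σ
  -- Closed, decreasing sets of approximate solutions of `Nm y = u`; a common point is an exact
  -- solution because the powers of the maximal ideal intersect in zero.
  let C : ℕ → Set (localIntegers p L) := fun n =>
    {y | Nm y - u ∈ maximalIdeal (localIntegers p L) ^ (n + 1)}
  have hmap := map_maximalIdeal_of_isUnramified h
  have hcl : ∀ n, IsClosed (C n) := fun n =>
    IsClosed.preimage (hNm.sub continuous_const)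
      (inferInstanceAs (IsClosed
        ((maximalIdeal (localIntegers p L) ^ (n + 1) : Ideal _) : Set (localIntegers p L))))
  obtain ⟨y, hy⟩ : (⋂ n, C n).Nonempty := by
    refine IsCompact.nonempty_iInter_of_sequence_nonempty_isCompact_isClosed C
      (fun n y hy => Ideal.pow_le_pow_right (Nat.le_succ _) hy) (fun n => ?_) (hcl 0).isCompact hcl
    have hmax : ((maximalIdeal (localIntegers p K)).map
        (algebraMap (localIntegers p K) (localIntegers p L))).IsMaximal := by
      rw [hmap]; infer_instance
    have : Finite (localIntegers p L ⧸ (maximalIdeal (localIntegers p K)).map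
        (algebraMap (localIntegers p K) (localIntegers p L))) := inferInstance
    obtain ⟨y, hy⟩ := exists_norm_sub_mem_maximalIdeal_pow (B := localIntegers p L) hmax hau n
    refine ⟨y, ?_⟩
    have := Ideal.mem_map_of_mem (algebraMap (localIntegers p K) (localIntegers p L)) hy
    rwa [Ideal.map_pow, hmap, map_sub, ha, algebraMap_norm_localIntegers] at this
  have hyu : Nm y = u := by
    have h1 := Ideal.iInf_pow_eq_bot_of_isLocalRing _
      (maximalIdeal.isMaximal (localIntegers p L)).ne_top
    rw [← sub_eq_zero, ← Ideal.mem_bot, ← h1, Ideal.mem_iInf]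
    exact fun n => Ideal.pow_le_pow_right (Nat.le_succ n) (Set.mem_iInter.1 hy n)
  -- `y` divides its norm, being the factor at `σ = 1`.
  have hyunit : IsUnit y := by
    have h1 : IsUnit (Nm y) := hyu ▸ u.isUnit
    exact isUnit_of_dvd_unit (Finset.dvd_prod_of_mem
      (fun σ : Gal(L/K) => galoisOnIntegers p K L σ y) (Finset.mem_univ 1)) h1
  refine ⟨.ofMul hyunit.unit, ?_⟩
  rw [← Additive.toMul.injective.eq_iff, toMul_sum]
  refine Units.ext ?_
  rw [Units.coe_prod]
  exact hyu

end UnramifiedLocalExtension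

theorem proposition3p2p5 (ℓ p : ℕ) [Fact ℓ.Prime] [Fact p.Prime]
    (K L : Type*) [Field K] [Field L]
    [Algebra ℚ_[p] K] [FiniteDimensional ℚ_[p] K]
    [Algebra ℚ_[p] L] [Algebra K L] [IsScalarTower ℚ_[p] K L]
    [FiniteDimensional K L] [IsGalois K L]
    (hℓ : IsPGroup ℓ Gal(L/K))
    (hunr : IsUnramifiedLocalExtension p K L)
    (i : ℤ) (hi : i = 0 ∨ i = 1) :
    Subsingleton (ellCohomology ℓ (ellUnitsRep p K L ℓ) i) := by
  have : FiniteDimensional ℚ_[p] L := FiniteDimensional.trans ℚ_[p] K L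
  obtain rfl | rfl := hi
  · exact subsingleton_ellCohomology_zero _ <|
      exists_norm_eq_ellAdification (galoisOnUnits p K L) isClosed_principalUnits
        (fun u => eq_zero_of_forall_mem_principalUnits) (fun n => Nat.card_pos.ne')
        card_smul_mem_principalUnits galoisOnUnits_mem_principalUnits
        (exists_norm_eq_of_isUnramified hunr)
  · exact subsingleton_ellCohomology_one _ <|
      exists_coboundary_eq_ellAdification (galoisOnUnits p K L) isClosed_principalUnits
        (fun u => eq_zero_of_forall_mem_principalUnits) (fun n => Nat.card_pos.ne')
        card_smul_mem_principalUnits galoisOnUnits_mem_principalUnits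
        (exists_coboundary_eq_of_isUnramified hunr)
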